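/- Let $n\ge 5$ and let $X=\mathbf P^2\times\mathbf P^{n-1}\subset\mathbf P^m$, $m=3\binom{n+1}{2}-1$, be the complex Segre--Veronese variety embedded by the complete linear system $\mathcal O(1,2)$, i.e. by all monomials $u_iv_jv_l$ of bidegree $(1,2)$. For a projective variety $W\subset\mathbf P^m$ and $k\ge1$ let the $k$-secant variety $\sigma_k(W)$ be the Zariski closure of $\bigcup_{x_1,\dots,x_k\in W}\langle x_1,\dots,x_k\rangle$, where $\langle\ \rangle$ denotes linear span; its expected dimension is $\min\{m,\,k\dim W+(k-1)\}$. Then $\sigma_{n+1}(X)$ has the expected dimension, and this dimension equals $(n+1)^2+n$. -/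

import Mathlib

open scoped LinearAlgebra.Projectivization

namespace SecantVariety

section Zariski

variable {K : Type*} [Field K] {ι : Type*}

/-- The common zero locus, in the projective space with homogeneous coordinates indexed by `ι`,
of a set of polynomials. It is used for sets of homogeneous polynomials only; for these, the choice
of the representative `p.rep` of the point `p` does not matter (`mk_mem_zeroLocus_iff`). -/
def zeroLocus (T : Set (MvPolynomial ι K)) : Set (ℙ K (ι → K)) :=
  {p | ∀ f ∈ T, MvPolynomial.eval p.rep f = 0}

/-- The algebraic subsets of projective space: the zero loci of sets of homogeneous polynomials
(of possibly different degrees). -/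
def IsAlgebraic (Z : Set (ℙ K (ι → K))) : Prop :=
  ∃ T : Set (MvPolynomial ι K), (∀ f ∈ T, ∃ d : ℕ, f.IsHomogeneous d) ∧ Z = zeroLocus T

theorem eval_smul_of_isHomogeneous {f : MvPolynomial ι K} {d : ℕ} (hf : f.IsHomogeneous d)
    (a : K) (v : ι → K) :
    MvPolynomial.eval (a • v) f = a ^ d * MvPolynomial.eval v f := by
  rw [MvPolynomial.eval_eq, MvPolynomial.eval_eq, Finset.mul_sum]
  refine Finset.sum_congr rfl fun m hm => ?_
  have hd : ∑ i ∈ m.support, m i = d := by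
    have h := hf (MvPolynomial.mem_support_iff.mp hm)
    rw [Finsupp.weight_apply] at h
    simpa [Finsupp.sum] using h
  simp only [Pi.smul_apply, smul_eq_mul, mul_pow, Finset.prod_mul_distrib]
  rw [Finset.prod_pow_eq_pow_sum, hd]
  ring

theorem mk_mem_zeroLocus_iff {T : Set (MvPolynomial ι K)}
    (hT : ∀ f ∈ T, ∃ d : ℕ, f.IsHomogeneous d) (v : ι → K) (hv : v ≠ 0) :
    Projectivization.mk K v hv ∈ zeroLocus T ↔ ∀ f ∈ T, MvPolynomial.eval v f = 0 := by
  obtain ⟨a, ha⟩ := Projectivization.exists_smul_eq_mk_rep K v hv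
  refine forall₂_congr fun f hf => ?_
  obtain ⟨d, hd⟩ := hT f hf
  rw [← ha, Units.smul_def, eval_smul_of_isHomogeneous hd]
  simp

theorem isAlgebraic_empty : IsAlgebraic (∅ : Set (ℙ K (ι → K))) := by
  refine ⟨{1}, ?_, ?_⟩
  · rintro f rfl
    exact ⟨0, MvPolynomial.isHomogeneous_one ι K⟩
  · ext p
    simp [zeroLocus]

theorem isAlgebraic_sInter (A : Set (Set (ℙ K (ι → K)))) (hA : ∀ Z ∈ A, IsAlgebraic Z) :
    IsAlgebraic (⋂₀ A) := by
  choose! T hT hZ using hA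
  refine ⟨⋃ Z ∈ A, T Z, ?_, ?_⟩
  · intro f hf
    simp only [Set.mem_iUnion] at hf
    obtain ⟨Z, hZA, hfZ⟩ := hf
    exact hT Z hZA f hfZ
  · ext p
    simp only [Set.mem_sInter, zeroLocus, Set.mem_iUnion, Set.mem_ofPred_eq]
    constructor
    · rintro h f ⟨Z, hZA, hfZ⟩
      have hp := h Z hZA
      rw [hZ Z hZA] at hp
      exact hp f hfZ
    · intro h Z hZA
      rw [hZ Z hZA]
      exact fun f hf => h f ⟨Z, hZA, hf⟩

theorem isAlgebraic_union {Z W : Set (ℙ K (ι → K))} (hZ : IsAlgebraic Z) (hW : IsAlgebraic W) :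
    IsAlgebraic (Z ∪ W) := by
  obtain ⟨S, hS, rfl⟩ := hZ
  obtain ⟨T, hT, rfl⟩ := hW
  refine ⟨Set.image2 (fun f g => f * g) S T, ?_, ?_⟩
  · rintro _ ⟨f, hf, g, hg, rfl⟩
    obtain ⟨a, ha⟩ := hS f hf
    obtain ⟨b, hb⟩ := hT g hg
    exact ⟨a + b, ha.mul hb⟩
  · ext p
    constructor
    · rintro (h | h) _ ⟨f, hf, g, hg, rfl⟩
      · simp [h f hf]
      · simp [h g hg]
    · intro h
      by_contra hp
      simp only [Set.mem_union, not_or, zeroLocus, Set.mem_ofPred_eq, not_forall] at hp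
      obtain ⟨⟨f, hf, hf0⟩, g, hg, hg0⟩ := hp
      have hfg := h (f * g) ⟨f, hf, g, hg, rfl⟩
      rw [map_mul] at hfg
      exact (mul_ne_zero hf0 hg0) hfg

/-- The Zariski topology on projective space: the closed sets are the algebraic sets. -/
instance zariskiTopology : TopologicalSpace (ℙ K (ι → K)) :=
  TopologicalSpace.ofClosed {Z | IsAlgebraic Z} isAlgebraic_empty
    (fun A hA => isAlgebraic_sInter A hA) (fun _ hZ _ hW => isAlgebraic_union hZ hW)

theorem isClosed_iff_isAlgebraic (Z : Set (ℙ K (ι → K))) : IsClosed Z ↔ IsAlgebraic Z := by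
  rw [← isOpen_compl_iff]
  change IsAlgebraic (Zᶜᶜ) ↔ _
  rw [compl_compl]

/-- The dimension of a subset of projective space: the Krull dimension of its Zariski (subspace)
topology, that is, the supremum of the lengths of chains of irreducible closed subsets. -/
noncomputable def dim (Z : Set (ℙ K (ι → K))) : WithBot ℕ∞ :=
  topologicalKrullDim Z

/-- The `k`-secant variety `σ_k(W)`: the Zariski closure of the union of the linear spans
`⟨x₁, …, x_k⟩` of `k` points of `W`. -/
def secantVariety (k : ℕ) (W : Set (ℙ K (ι → K))) : Set (ℙ K (ι → K)) :=
  closure {p | ∃ x : Fin k → ℙ K (ι → K),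
    (∀ i, x i ∈ W) ∧ p.submodule ≤ ⨆ i, (x i).submodule}

/-- The expected dimension `min {m, k * dim W + (k - 1)}` of `σ_k(W)`, for `k ≥ 1`, where `m` is the
dimension of the ambient projective space. -/
noncomputable def expectedDim (k : ℕ) (W : Set (ℙ K (ι → K))) : WithBot ℕ∞ :=
  min (dim (Set.univ : Set (ℙ K (ι → K)))) ((k : WithBot ℕ∞) * dim W + ((k - 1 : ℕ) : WithBot ℕ∞))

end Zariski

section SegreVeronese

variable {K : Type*} [Field K] {α β : Type*}

/-- All monomials `u_i v_j v_l` of bidegree `(1, 2)` in two vectors of coordinates; the unordered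
pair `s = {j, l}` (where `j = l` is allowed) contributes the factor `v_j v_l`. -/
def monomials12 (u : α → K) (v : β → K) : α × Sym2 β → K :=
  fun m => u m.1 * (m.2.map v).mul

theorem monomials12_ne_zero {u : α → K} {v : β → K} (hu : u ≠ 0) (hv : v ≠ 0) :
    monomials12 u v ≠ 0 := by
  obtain ⟨i, hi⟩ := Function.ne_iff.mp hu
  obtain ⟨j, hj⟩ := Function.ne_iff.mp hv
  refine Function.ne_iff.mpr ⟨(i, s(j, j)), ?_⟩
  simpa [monomials12] using And.intro hi hj

/-- The Segre-Veronese map `ℙ(U) × ℙ(V) → ℙ(U ⊗ S² V)` given in coordinates by all monomials of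
bidegree `(1, 2)`, that is, by the complete linear system `𝒪(1, 2)`. -/
noncomputable def segreVeroneseMap (x : ℙ K (α → K) × ℙ K (β → K)) : ℙ K (α × Sym2 β → K) :=
  Projectivization.mk K (monomials12 x.1.rep x.2.rep)
    (monomials12_ne_zero x.1.rep_nonzero x.2.rep_nonzero)

theorem segreVeroneseMap_mk (u : α → K) (v : β → K) (hu : u ≠ 0) (hv : v ≠ 0) :
    segreVeroneseMap (Projectivization.mk K u hu, Projectivization.mk K v hv) =
      Projectivization.mk K (monomials12 u v) (monomials12_ne_zero hu hv) := by
  obtain ⟨a, ha⟩ := Projectivization.exists_smul_eq_mk_rep K u hu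
  obtain ⟨b, hb⟩ := Projectivization.exists_smul_eq_mk_rep K v hv
  refine (Projectivization.mk_eq_mk_iff K _ _ _ _).mpr ⟨a * b ^ 2, ?_⟩
  funext m
  obtain ⟨i, s⟩ := m
  induction s with
  | _ j l =>
    simp only [monomials12, ← ha, ← hb, Units.smul_def, Pi.smul_apply, smul_eq_mul, Sym2.map_mk,
      Sym2.mul_mk, Units.val_mul, Units.val_pow_eq_pow_val]
    ring

end SegreVeronese

/-- The Segre-Veronese variety `X = ℙ² × ℙⁿ⁻¹` over `ℂ`, embedded by `𝒪(1, 2)`. -/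
noncomputable def segreVeronese (n : ℕ) : Set (ℙ ℂ (Fin 3 × Sym2 (Fin n) → ℂ)) :=
  Set.range (segreVeroneseMap : ℙ ℂ (Fin 3 → ℂ) × ℙ ℂ (Fin n → ℂ) → _)

end SecantVariety

-- This is Terracini's argument at explicit points. A sum of n+1 vectors u ⊗ v², with one coordinate
-- of each v scaled to 1, has (n+1)(n+2) parameters, so dim σ_{n+1}(X) ≤ (n+1)(n+2) − 1 = (n+1)² +
-- n. Equality follows once the normalised differential is injective at a single choice of points
-- (`eq_zero_of_secantTangent_eq_zero`): (0,1,0) ⊗ (1,…,1)² and (1,t_j,t_j²) ⊗ e_j² with t_j = j+1.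
-- In the equations with j ≠ l, the last n points contribute just two unknowns, with weights on a
-- conic; the coefficients of (T − t_j)(T − t_l) eliminate them and leave a system at the first
-- point alone, which has only the zero solution for n ≥ 5.
--
-- Krull dimension is controlled by `coneDim`. It grows strictly along irreducible closed sets,
-- which bounds `dim` above. For the lower bound, the Jacobian criterion gives the images of a flag
-- of affine subspaces `coneDim` 1, 2, …, N+1, so their closures form a chain of length N
-- (`dim_eq_of_secantTangent_injective`). The same argument with one summand gives dim X = n+1,
-- hence the expected dimension.

universe u v w

/-! ### Jacobian criterion and transcendence degree. -/

namespace MvPolynomial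

variable {R σ τ : Type*} [CommRing R]

theorem pderiv_aeval [Fintype τ] (g : τ → MvPolynomial σ R) (F : MvPolynomial τ R) (j : σ) :
    pderiv j (aeval g F) = ∑ i, aeval g (pderiv i F) * pderiv j (g i) := by
  induction F using MvPolynomial.induction_on with
  | C a => simp
  | add p q hp hq => simp only [map_add, hp, hq, add_mul, Finset.sum_add_distrib]
  | mul_X p k hp =>
    classical
    rw [map_mul, pderiv_mul, hp, aeval_X]
    simp only [pderiv_mul, map_add, map_mul, aeval_X, pderiv_X, add_mul, Finset.sum_add_distrib,
      Finset.sum_mul]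
    congr 1
    · exact Finset.sum_congr rfl fun i _ => by ring
    · rw [Finset.sum_eq_single k]
      · simp
      · intro b _ hb
        simp [hb.symm]
      · simp

theorem eq_C_of_pderiv_eq_zero [NoZeroDivisors R] [CharZero R] {F : MvPolynomial σ R}
    (h : ∀ i, pderiv i F = 0) : F = C (coeff 0 F) := by
  classical
  ext m
  rw [coeff_C]
  split_ifs with hm
  · rw [hm]
  · obtain ⟨i, hi⟩ := Finsupp.ne_iff.mp (Ne.symm hm)
    have hi' : 1 ≤ m i := Nat.one_le_iff_ne_zero.mpr hi
    have hc := congrArg (coeff (m - Finsupp.single i 1)) (h i)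
    rw [coeff_pderiv, coeff_zero,
      tsub_add_cancel_of_le (Finsupp.single_le_iff.mpr hi')] at hc
    rcases mul_eq_zero.mp hc with hc | hc
    · exact hc
    · exact absurd hc (Nat.cast_add_one_ne_zero _)

theorem coeff_pderiv_eq_zero_of_degree {F : MvPolynomial σ R} {d : ℕ}
    (h : ∀ m, d < m.degree → coeff m F = 0) (i : σ) (m : σ →₀ ℕ) (hm : d - 1 < m.degree) :
    coeff m (pderiv i F) = 0 := by
  rw [coeff_pderiv, h, zero_mul]
  rw [map_add, Finsupp.degree_single]
  omega

/-- Differentiating F(g) = 0 gives a vector (∂ᵢF)(g) annihilated by the Jacobian matrix, hence zero.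
So each ∂ᵢF is a relation of lower degree and vanishes by induction; in characteristic zero F is
then a constant, and F(g) = 0 makes it 0. -/
theorem algebraicIndependent_of_jacobian_ne_zero [IsDomain R] [CharZero R] [Fintype σ]
    [DecidableEq σ] (g : σ → MvPolynomial σ R)
    (h : (Matrix.of fun i j => pderiv j (g i)).det ≠ 0) : AlgebraicIndependent R g := by
  rw [algebraicIndependent_iff]
  suffices ∀ (d : ℕ) (F : MvPolynomial σ R), (∀ m, d < m.degree → coeff m F = 0) →
      aeval g F = 0 → F = 0 from fun F hF =>
    this F.totalDegree F (fun m hm => coeff_eq_zero_of_totalDegree_lt (by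
      rwa [← Finsupp.degree_apply])) hF
  have hconst : ∀ F : MvPolynomial σ R, (∀ i, pderiv i F = 0) → aeval g F = 0 → F = 0 := by
    intro F hF h0
    rw [eq_C_of_pderiv_eq_zero hF] at h0 ⊢
    rw [aeval_C] at h0
    rw [(C_injective σ R) (a₁ := coeff 0 F) (a₂ := 0) (by simpa using h0), C_0]
  intro d
  induction d with
  | zero =>
    intro F hF h0
    refine hconst F (fun i => ?_) h0
    ext m
    rw [coeff_pderiv, hF, zero_mul, coeff_zero]
    rw [map_add, Finsupp.degree_single]
    omega
  | succ d ih =>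
    intro F hF h0
    refine hconst F (fun i => ih _ (fun m hm => ?_) ?_) h0
    · exact coeff_pderiv_eq_zero_of_degree hF i m (by simpa using hm)
    · have hv : Matrix.vecMul (fun i => aeval g (pderiv i F))
          (Matrix.of fun i j => pderiv j (g i)) = 0 := by
        funext j
        have := pderiv_aeval g F j
        rw [h0, map_zero] at this
        simpa [Matrix.vecMul, dotProduct] using this.symm
      exact congrFun (Matrix.eq_zero_of_vecMul_eq_zero h hv) i

end MvPolynomial

/-- Adjoining b to x keeps independence: after cancelling powers of b, an equation for b over R[x]
has nonzero constant term, yet f sends that term to 0 although f is injective on R[x]. -/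
theorem mk_option_le_trdeg_of_algebraicIndependent_comp {R : Type u} {A : Type v} {B : Type w} [CommRing R]
    [CommRing A] [IsDomain A] [CommRing B] [Nontrivial R]
    [Algebra R A] [Algebra R B] (f : A →ₐ[R] B)
    {b : A} (hb : b ≠ 0) (hfb : f b = 0) {τ : Type v} {x : τ → A}
    (hx : AlgebraicIndependent R (f ∘ x)) :
    Cardinal.mk (Option τ) ≤ Algebra.trdeg R A := by
  have hxA : AlgebraicIndependent R x := hx.of_comp f
  refine ((hxA.option_iff_transcendental b).mpr ?_).cardinalMk_le_trdeg
  intro halg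
  obtain ⟨q, hq0, hq⟩ := halg.exists_nonzero_coeff_and_aeval_eq_zero (mem_nonZeroDivisors_of_ne_zero hb)
  have hinj : Set.InjOn f (Algebra.adjoin R (Set.range x)) := by
    intro y hy z hz hyz
    rw [SetLike.mem_coe, Algebra.adjoin_range_eq_range_aeval] at hy hz
    obtain ⟨p, rfl⟩ := hy
    obtain ⟨r, rfl⟩ := hz
    have h1 : ∀ p : MvPolynomial τ R, f (MvPolynomial.aeval x p) = MvPolynomial.aeval (f ∘ x) p :=
      fun p => (MvPolynomial.comp_aeval_apply x f p)
    simp only [AlgHom.toRingHom_eq_coe, RingHom.coe_coe] at hyz ⊢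
    rw [h1, h1] at hyz
    rw [hx hyz]
  apply hq0
  have : f (q.coeff 0 : A) = f 0 := by
    have h2 := congrArg f hq
    rw [Polynomial.aeval_def, ← Polynomial.eval_map, ← Polynomial.divX_mul_X_add (Polynomial.map _ q)] at h2
    simpa [hfb] using h2
  exact Subtype.ext (hinj (q.coeff 0).2 (zero_mem _) this)

theorem trdeg_lt_trdeg_of_surjective {R : Type u} {A B : Type v} [CommRing R] [Nontrivial R]
    [CommRing A] [IsDomain A] [CommRing B] [NoZeroDivisors B] [Algebra R A] [Algebra R B]
    [FaithfulSMul R B]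
    (f : A →ₐ[R] B) (hf : Function.Surjective f) {b : A} (hb : b ≠ 0) (hfb : f b = 0)
    (hfin : Algebra.trdeg R A < Cardinal.aleph0) : Algebra.trdeg R B < Algebra.trdeg R A := by
  obtain ⟨τ, y, hy⟩ := exists_isTranscendenceBasis' R B
  choose x hx using fun i => hf (y i)
  have hfx : f ∘ x = y := funext hx
  have h := mk_option_le_trdeg_of_algebraicIndependent_comp f hb hfb (x := x)
    (by rw [hfx]; exact hy.1)
  rw [Cardinal.mk_option] at h
  have hB : Cardinal.mk τ = Algebra.trdeg R B := hy.cardinalMk_eq_trdeg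
  rw [hB] at h
  refine lt_of_lt_of_le ?_ h
  have hBfin : Algebra.trdeg R B < Cardinal.aleph0 :=
    (le_self_add.trans h).trans_lt hfin
  obtain ⟨n, hn⟩ := Cardinal.lt_aleph0.mp hBfin
  rw [hn]
  exact_mod_cast Nat.lt_succ_self n

/-- A left inverse of the Jacobian at q recombines the `a i` linearly into `card σ` elements whose
Jacobian at q is the identity, so the square criterion applies. -/
theorem card_le_trdeg_of_jacobian_injective {K : Type u} {σ ι : Type v} {A : Type w} [Field K]
    [CharZero K] [CommRing A] [Algebra K A] [Fintype σ] [Fintype ι]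
    (φ : A →ₐ[K] MvPolynomial σ K) (a : ι → A) (q : σ → K)
    (h : ∀ c : σ → K, (∀ i, ∑ k, c k * MvPolynomial.eval q (MvPolynomial.pderiv k (φ (a i))) = 0) →
      c = 0) :
    (Fintype.card σ : Cardinal) ≤ Algebra.trdeg K A := by
  classical
  let M : Matrix ι σ K := Matrix.of fun i k =>
    MvPolynomial.eval q (MvPolynomial.pderiv k (φ (a i)))
  have hM : LinearMap.ker M.toLin' = ⊥ := by
    rw [LinearMap.ker_eq_bot']
    intro c hc
    refine h c fun i => ?_
    have := congrFun hc i
    simpa [M, Matrix.mulVec, dotProduct, mul_comm] using this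
  obtain ⟨B, hB⟩ := M.toLin'.exists_leftInverse_of_injective hM
  have hBM : LinearMap.toMatrix' B * M = 1 := by
    have := congrArg LinearMap.toMatrix' hB
    rwa [LinearMap.toMatrix'_comp, LinearMap.toMatrix'_toLin', LinearMap.toMatrix'_id] at this
  let a' : σ → A := fun k => ∑ i, LinearMap.toMatrix' B k i • a i
  have hind : AlgebraicIndependent K (φ ∘ a') := by
    refine MvPolynomial.algebraicIndependent_of_jacobian_ne_zero _ fun h0 => ?_
    have h1 := congrArg (MvPolynomial.eval q) h0
    rw [RingHom.map_det, map_zero] at h1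
    have h2 : (MvPolynomial.eval q).mapMatrix
        (Matrix.of fun i j => MvPolynomial.pderiv j ((φ ∘ a') i)) = 1 := by
      rw [← hBM]
      ext i j
      simp [a', M, Matrix.mul_apply, MvPolynomial.smul_eval]
    rw [h2, Matrix.det_one] at h1
    exact one_ne_zero h1
  have := (hind.of_comp φ).lift_cardinalMk_le_trdeg
  rw [Cardinal.mk_fintype, Cardinal.lift_natCast] at this
  exact Cardinal.nat_le_lift_iff.mp this

/-! ### Vanishing ideals and the dimension of the cone. -/

namespace SecantVariety

section VanishingIdeal

open MvPolynomial

variable {K : Type u} [Field K] {ι : Type v}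

/-- The ideal of all polynomials vanishing on the affine cone over a subset of projective space. -/
def vanishingIdeal (S : Set (ℙ K (ι → K))) : Ideal (MvPolynomial ι K) where
  carrier := {f | ∀ (v : ι → K) (hv : v ≠ 0), Projectivization.mk K v hv ∈ S → eval v f = 0}
  add_mem' hf hg v hv hS := by rw [map_add, hf v hv hS, hg v hv hS, add_zero]
  zero_mem' v _ _ := map_zero _
  smul_mem' c f hf v hv hS := by rw [smul_eq_mul, map_mul, hf v hv hS, mul_zero]

theorem mem_vanishingIdeal {S : Set (ℙ K (ι → K))} {f : MvPolynomial ι K} :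
    f ∈ vanishingIdeal S ↔
      ∀ (v : ι → K) (hv : v ≠ 0), Projectivization.mk K v hv ∈ S → eval v f = 0 :=
  Iff.rfl

theorem vanishingIdeal_anti {S T : Set (ℙ K (ι → K))} (h : S ⊆ T) :
    vanishingIdeal T ≤ vanishingIdeal S :=
  fun _ hf v hv hS => hf v hv (h hS)

theorem mk_smul {a : K} {v : ι → K} (hv : v ≠ 0) (hav : a • v ≠ 0) :
    Projectivization.mk K (a • v) hav = Projectivization.mk K v hv :=
  (Projectivization.mk_eq_mk_iff' K _ _ _ _).mpr ⟨a, rfl⟩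

theorem eval_rep_eq_zero {S : Set (ℙ K (ι → K))} {f : MvPolynomial ι K}
    (hf : f ∈ vanishingIdeal S) {p : ℙ K (ι → K)} (hp : p ∈ S) : eval p.rep f = 0 :=
  hf p.rep p.rep_nonzero (by rwa [p.mk_rep])

theorem homogeneousComponent_mem_vanishingIdeal [Infinite K] {S : Set (ℙ K (ι → K))}
    {f : MvPolynomial ι K} (hf : f ∈ vanishingIdeal S) (d : ℕ) :
    homogeneousComponent d f ∈ vanishingIdeal S := by
  intro v hv hS
  by_cases hd : d < f.totalDegree + 1
  · let P : Polynomial K := ∑ e ∈ Finset.range (f.totalDegree + 1),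
      Polynomial.C (eval v (homogeneousComponent e f)) * Polynomial.X ^ e
    -- The factor `X` covers a = 0, where a • v represents no projective point.
    have hP : P * Polynomial.X = 0 := by
      refine Polynomial.funext fun a => ?_
      rw [Polynomial.eval_mul, Polynomial.eval_X, Polynomial.eval_zero]
      rcases eq_or_ne a 0 with rfl | ha
      · rw [mul_zero]
      · have hav : a • v ≠ 0 := smul_ne_zero ha hv
        have h0 := hf (a • v) hav (by rwa [mk_smul hv hav])
        rw [← sum_homogeneousComponent f, map_sum] at h0
        have : P.eval a = 0 := by
          rw [← h0, Polynomial.eval_finsetSum]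
          refine Finset.sum_congr rfl fun e _ => ?_
          rw [eval_smul_of_isHomogeneous (homogeneousComponent_isHomogeneous e f)]
          rw [Polynomial.eval_mul, Polynomial.eval_C, Polynomial.eval_pow, Polynomial.eval_X, mul_comm]
        rw [this, zero_mul]
    have hP0 : P = 0 := (mul_eq_zero.mp hP).resolve_right Polynomial.X_ne_zero
    have := congrArg (Polynomial.coeff · d) hP0
    simpa [P, Polynomial.finsetSum_coeff, Polynomial.coeff_X_pow, Finset.sum_ite_eq, hd,
      Polynomial.coeff_C_mul] using this
  · rw [homogeneousComponent_eq_zero d f (by omega), map_zero]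

theorem mem_closure_iff_forall_isHomogeneous {S : Set (ℙ K (ι → K))} {p : ℙ K (ι → K)} :
    p ∈ closure S ↔
      ∀ f ∈ vanishingIdeal S, (∃ d, f.IsHomogeneous d) → eval p.rep f = 0 := by
  constructor
  · rintro hp f hf ⟨d, hd⟩
    have hcl : IsClosed (zeroLocus {f}) :=
      (isClosed_iff_isAlgebraic _).mpr ⟨{f}, by rintro _ rfl; exact ⟨d, hd⟩, rfl⟩
    have hS : S ⊆ zeroLocus {f} := by
      rintro q hq _ rfl
      exact eval_rep_eq_zero hf hq
    exact closure_minimal hS hcl hp f rfl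
  · intro h
    obtain ⟨T, hT, hZ⟩ := (isClosed_iff_isAlgebraic _).mp (isClosed_closure (s := S))
    rw [hZ]
    intro f hf
    refine h f (fun v hv hvS => ?_) (hT f hf)
    have := subset_closure hvS
    rw [hZ] at this
    exact (mk_mem_zeroLocus_iff hT v hv).mp this f hf

theorem vanishingIdeal_closure [Infinite K] (S : Set (ℙ K (ι → K))) :
    vanishingIdeal (closure S) = vanishingIdeal S := by
  refine le_antisymm (vanishingIdeal_anti subset_closure) fun f hf v hv hS => ?_
  rw [← sum_homogeneousComponent f, map_sum]
  refine Finset.sum_eq_zero fun d _ => ?_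
  have hd := homogeneousComponent_isHomogeneous d f
  have := mem_closure_iff_forall_isHomogeneous.mp hS _
    (homogeneousComponent_mem_vanishingIdeal hf d) ⟨d, hd⟩
  obtain ⟨a, ha⟩ := Projectivization.exists_smul_eq_mk_rep K v hv
  rw [← ha, Units.smul_def, eval_smul_of_isHomogeneous hd] at this
  exact (mul_eq_zero.mp this).resolve_left (pow_ne_zero _ a.ne_zero)

theorem closure_le_closure_of_vanishingIdeal_le {S T : Set (ℙ K (ι → K))}
    (h : vanishingIdeal T ≤ vanishingIdeal S) : closure S ⊆ closure T := by
  intro p hp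
  rw [mem_closure_iff_forall_isHomogeneous] at hp ⊢
  exact fun f hf => hp f (h hf)

attribute [local instance] MvPolynomial.gradedAlgebra

/-- The ideal is homogeneous, so primality need only be tested on homogeneous f and g, whose zero
loci are closed and together cover S when fg vanishes on S. -/
theorem vanishingIdeal_isPrime [Infinite K] {S : Set (ℙ K (ι → K))} (hS : IsIrreducible S) :
    (vanishingIdeal S).IsPrime := by
  refine Ideal.IsHomogeneous.isPrime_of_homogeneous_mem_or_mem
    (𝒜 := homogeneousSubmodule ι K) ?_ ?_ ?_
  · intro d f hf
    have h : ((DirectSum.decompose (homogeneousSubmodule ι K) f) d : MvPolynomial ι K) =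
      homogeneousComponent d f := decomposition.decompose'_apply f d
    rw [h]
    exact homogeneousComponent_mem_vanishingIdeal hf d
  · obtain ⟨p, hp⟩ := hS.nonempty
    rw [Ne, Ideal.eq_top_iff_one]
    intro h1
    simpa using eval_rep_eq_zero h1 hp
  · rintro f g ⟨a, ha⟩ ⟨b, hb⟩ hfg
    have hcl : ∀ {f : MvPolynomial ι K} {d : ℕ}, f.IsHomogeneous d →
        IsClosed (zeroLocus {f} : Set (ℙ K (ι → K))) := fun {f d} hf =>
      (isClosed_iff_isAlgebraic _).mpr ⟨{f}, by rintro _ rfl; exact ⟨d, hf⟩, rfl⟩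
    have hmem : ∀ {f : MvPolynomial ι K} {d : ℕ}, f.IsHomogeneous d → S ⊆ zeroLocus {f} →
        f ∈ vanishingIdeal S := fun {f d} hf hSf v hv hvS =>
      (mk_mem_zeroLocus_iff (by rintro _ rfl; exact ⟨d, hf⟩) v hv).mp (hSf hvS) f rfl
    have hcov : S ⊆ zeroLocus {f} ∪ zeroLocus {g} := by
      intro p hp
      have := eval_rep_eq_zero hfg hp
      rw [map_mul, mul_eq_zero] at this
      exact this.imp (fun h _ hf => hf ▸ h) (fun h _ hg => hg ▸ h)
    rcases (isPreirreducible_iff_isClosed_union_isClosed.mp hS.isPreirreducible) _ _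
      (hcl ha) (hcl hb) hcov with h | h
    · exact Or.inl (hmem ha h)
    · exact Or.inr (hmem hb h)

/-- The transcendence degree of the homogeneous coordinate ring of a subset of projective space. -/
noncomputable def coneDim (S : Set (ℙ K (ι → K))) : Cardinal :=
  Algebra.trdeg K (MvPolynomial ι K ⧸ vanishingIdeal S)

theorem coneDim_lt_aleph0 [Finite ι] (S : Set (ℙ K (ι → K))) : coneDim S < Cardinal.aleph0 :=
  trdeg_lt_aleph0_of_finiteType

theorem coneDim_mono {S T : Set (ℙ K (ι → K))} (h : vanishingIdeal T ≤ vanishingIdeal S) :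
    coneDim S ≤ coneDim T :=
  trdeg_le_of_surjective (Ideal.Quotient.factorₐ K h) (Ideal.Quotient.factor_surjective h)

theorem coneDim_strictMono [Infinite K] [Finite ι] {S T : Set (ℙ K (ι → K))}
    (hS : IsIrreducible S) (hT : IsIrreducible T)
    (h : vanishingIdeal T < vanishingIdeal S) : coneDim S < coneDim T := by
  have := vanishingIdeal_isPrime hS
  have := vanishingIdeal_isPrime hT
  obtain ⟨f, hfS, hfT⟩ := SetLike.exists_of_lt h
  refine trdeg_lt_trdeg_of_surjective (Ideal.Quotient.factorₐ K h.le)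
    (Ideal.Quotient.factor_surjective h.le) (b := Ideal.Quotient.mk _ f) ?_ ?_
    (coneDim_lt_aleph0 T)
  · rwa [Ne, Ideal.Quotient.eq_zero_iff_mem]
  · exact (Ideal.Quotient.eq_zero_iff_mem).mpr hfS

theorem coneDim_le_of_ker_le {τ : Type v} [Fintype τ] {S : Set (ℙ K (ι → K))}
    (θ : MvPolynomial ι K →ₐ[K] MvPolynomial τ K)
    (h : ∀ F, θ F = 0 → F ∈ vanishingIdeal S) : coneDim S ≤ Fintype.card τ := by
  have h' : RingHom.ker θ ≤ vanishingIdeal S := fun F hF => h F hF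
  refine (trdeg_le_of_surjective (Ideal.Quotient.factorₐ K h')
    (Ideal.Quotient.factor_surjective h')).trans ?_
  refine (trdeg_le_of_injective (Ideal.kerLiftAlg θ) (Ideal.kerLiftAlg_injective θ)).trans ?_
  rw [MvPolynomial.trdeg_of_isDomain, Cardinal.mk_fintype, Cardinal.lift_natCast]

end VanishingIdeal

end SecantVariety

/-! ### Sets parametrized by polynomials. -/

namespace SecantVariety

section ParametrizedSet

open MvPolynomial

variable {K : Type u} [Field K] {ι τ : Type v}

/-- The subset of projective space parametrized by a family of polynomials. -/
def parametrizedSet (f : ι → MvPolynomial τ K) : Set (ℙ K (ι → K)) :=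
  {p | ∃ (t : τ → K) (h : (fun i => eval t (f i)) ≠ 0), p = Projectivization.mk K _ h}

/-- The parametrization of the cone over `parametrizedSet f`, as a map of polynomial rings. -/
noncomputable def coneHom (f : ι → MvPolynomial τ K) :
    MvPolynomial ι K →ₐ[K] MvPolynomial (Option τ) K :=
  aeval fun i => X none * rename some (f i)

theorem eval_coneHom (f : ι → MvPolynomial τ K) (x : Option τ → K) (F : MvPolynomial ι K) :
    eval x (coneHom f F) = eval (x none • fun i => eval (x ∘ some) (f i)) F := by
  induction F using MvPolynomial.induction_on with
  | C a => simp [coneHom]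
  | add p q hp hq => rw [map_add, map_add, map_add, hp, hq]
  | mul_X p i hp =>
    rw [map_mul, map_mul, map_mul, hp]
    simp [coneHom, eval_rename]

theorem coneHom_eq_zero_of_mem [Infinite K] {S : Set (ℙ K (ι → K))} {f : ι → MvPolynomial τ K}
    (hf : f ≠ 0) (hS : parametrizedSet f ⊆ S) {F : MvPolynomial ι K}
    (hF : F ∈ vanishingIdeal S) : coneHom f F = 0 := by
  obtain ⟨i, hi⟩ := Function.ne_iff.mp hf
  -- Vanishing of F on S says nothing where the scale or the whole parametrization is zero;
  -- multiplying by this nonzero polynomial discards that locus.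
  have hne : X none * rename some (f i) ≠ (0 : MvPolynomial (Option τ) K) :=
    mul_ne_zero (X_ne_zero _)
      ((map_ne_zero_iff _ (rename_injective _ (Option.some_injective τ))).mpr hi)
  refine (mul_eq_zero.mp (MvPolynomial.funext fun x => ?_)).resolve_right hne
  rw [map_mul, map_zero, eval_coneHom, map_mul, eval_X, eval_rename]
  by_cases hx : x none = 0
  · rw [hx, zero_mul, mul_zero]
  by_cases hfx : eval (x ∘ some) (f i) = 0
  · rw [hfx, mul_zero, mul_zero]
  have h0 : (fun i => eval (x ∘ some) (f i)) ≠ 0 := Function.ne_iff.mpr ⟨i, hfx⟩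
  rw [hF _ (smul_ne_zero hx h0), zero_mul]
  rw [mk_smul h0]
  exact hS ⟨_, h0, rfl⟩

theorem mem_vanishingIdeal_of_coneHom_eq_zero {f : ι → MvPolynomial τ K} {F : MvPolynomial ι K}
    (hF : coneHom f F = 0) : F ∈ vanishingIdeal (parametrizedSet f) := by
  rintro v hv ⟨t, h, ht⟩
  obtain ⟨a, ha⟩ := (Projectivization.mk_eq_mk_iff' K _ _ _ _).mp ht
  have := eval_coneHom f (fun o => o.elim a t) F
  rw [hF, map_zero] at this
  rw [← ha]
  exact this.symm

theorem coneDim_parametrizedSet_le [Fintype τ] (f : ι → MvPolynomial τ K) :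
    coneDim (parametrizedSet f) ≤ (Fintype.card τ + 1 : ℕ) := by
  rw [← Fintype.card_option]
  exact coneDim_le_of_ker_le (coneHom f) fun _ => mem_vanishingIdeal_of_coneHom_eq_zero

/-- The hypothesis is injectivity of the differential of the cone parametrization at scale 1 and t =
0: the scale variable contributes f(0), the others the partial derivatives. -/
theorem le_coneDim [CharZero K] [Fintype τ] [Fintype ι] {S : Set (ℙ K (ι → K))}
    {f : ι → MvPolynomial τ K} (hS : parametrizedSet f ⊆ S)
    (h : ∀ (a : K) (c : τ → K),
      (∀ i, a * eval 0 (f i) + ∑ k, c k * eval 0 (pderiv k (f i)) = 0) → a = 0 ∧ c = 0) :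
    ((Fintype.card τ + 1 : ℕ) : Cardinal) ≤ coneDim S := by
  have hf : f ≠ 0 := by
    rintro rfl
    exact one_ne_zero (h 1 0 (fun i => by simp)).1
  rw [← Fintype.card_option]
  refine card_le_trdeg_of_jacobian_injective
    (Ideal.Quotient.liftₐ (vanishingIdeal S) (coneHom f)
      fun F hF => coneHom_eq_zero_of_mem hf hS hF)
    (fun i => Ideal.Quotient.mk _ (X i)) (fun o => o.elim 1 0) fun c hc => ?_
  have hnone : ∀ i, eval (fun o : Option τ => o.elim 1 0) (pderiv none (coneHom f (X i))) =
      eval 0 (f i) := by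
    intro i
    have : pderiv none (rename some (f i)) = 0 :=
      pderiv_eq_zero_of_notMem_vars fun hmem => by
        classical
        obtain ⟨j, -, hj⟩ := Finset.mem_image.mp (vars_rename _ _ hmem)
        exact Option.some_ne_none j hj
    rw [coneHom, aeval_X, pderiv_mul, this, pderiv_X_self, one_mul, mul_zero, add_zero, eval_rename]
    rfl
  have hsome : ∀ i k, eval (fun o : Option τ => o.elim 1 0) (pderiv (some k) (coneHom f (X i))) =
      eval 0 (pderiv k (f i)) := by
    intro i k
    rw [coneHom, aeval_X, pderiv_mul, pderiv_X_of_ne (by simp), zero_mul, zero_add,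
      pderiv_rename (Option.some_injective τ), map_mul, eval_X, eval_rename]
    exact one_mul _
  obtain ⟨h1, h2⟩ := h (c none) (fun k => c (some k)) fun i => by
    have := hc i
    rw [Fintype.sum_option] at this
    simp only [Ideal.Quotient.liftₐ_apply] at this
    rw [← hnone i]
    simp only [← hsome i]
    exact this
  funext o
  cases o with
  | none => exact h1
  | some k => exact congrFun h2 k

theorem one_le_coneDim [CharZero K] [Fintype ι] {S : Set (ℙ K (ι → K))} (hS : S.Nonempty) :
    1 ≤ coneDim S := by
  obtain ⟨p, hp⟩ := hS
  have := le_coneDim (S := S) (τ := PEmpty) (f := fun i => C (p.rep i)) ?_ ?_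
  · simpa using this
  · rintro q ⟨t, h, rfl⟩
    convert! hp
    conv_rhs => rw [← p.mk_rep]
    simp
  · intro a c h
    refine ⟨?_, Subsingleton.elim _ _⟩
    obtain ⟨i, hi⟩ := Function.ne_iff.mp p.rep_nonzero
    have := h i
    simp only [eval_C, Finset.univ_eq_empty, Finset.sum_empty, add_zero] at this
    exact (mul_eq_zero.mp this).resolve_right hi

/-- Each nonempty open subset contains the image of a locus F ≠ 0 with F a nonzero polynomial; a
product of nonzero polynomials has a non-root over an infinite field. -/
theorem parametrizedSet_isIrreducible [Infinite K] {f : ι → MvPolynomial τ K} (hf : f ≠ 0) :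
    IsIrreducible (parametrizedSet f) := by
  obtain ⟨i, hi⟩ := Function.ne_iff.mp hf
  have hex : ∀ F : MvPolynomial τ K, F ≠ 0 → ∃ t, eval t F ≠ 0 := by
    intro F hF
    by_contra! h
    exact hF (MvPolynomial.funext fun t => by rw [h t, map_zero])
  have heval : ∀ (F : MvPolynomial ι K) t, eval t (aeval f F) = eval (fun i => eval t (f i)) F := by
    intro F t
    induction F using MvPolynomial.induction_on with
    | C a => simp
    | add p q hp hq => rw [map_add, map_add, map_add, hp, hq]
    | mul_X p i hp => rw [map_mul, map_mul, map_mul, hp, aeval_X, eval_X]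
  refine ⟨?_, ?_⟩
  · obtain ⟨t, ht⟩ := hex _ hi
    exact ⟨_, t, Function.ne_iff.mpr ⟨i, ht⟩, rfl⟩
  · have key : ∀ U : Set (ℙ K (ι → K)), IsOpen U → (parametrizedSet f ∩ U).Nonempty →
        ∃ F : MvPolynomial τ K, F ≠ 0 ∧ ∀ t (h : (fun i => eval t (f i)) ≠ 0), eval t F ≠ 0 →
          Projectivization.mk K _ h ∈ U := by
      rintro U hU ⟨_, ⟨t, h, rfl⟩, htU⟩
      obtain ⟨T, hT, hUT⟩ := (isClosed_iff_isAlgebraic _).mp hU.isClosed_compl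
      have hmem : ∀ p, p ∈ U ↔ p ∉ zeroLocus T := fun p => by rw [← hUT, Set.notMem_compl_iff]
      rw [hmem, mk_mem_zeroLocus_iff hT] at htU
      push Not at htU
      obtain ⟨F, hFT, hF⟩ := htU
      refine ⟨aeval f F, fun h0 => hF ?_, fun s hs hFs => ?_⟩
      · rw [← heval, h0, map_zero]
      · rw [hmem, mk_mem_zeroLocus_iff hT]
        intro hall
        exact hFs (by rw [heval]; exact hall F hFT)
    intro U V hU hV hSU hSV
    obtain ⟨F, hF, hFU⟩ := key U hU hSU
    obtain ⟨G, hG, hGV⟩ := key V hV hSV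
    obtain ⟨t, ht⟩ := hex _ (mul_ne_zero (mul_ne_zero hF hG) hi)
    rw [map_mul, map_mul] at ht
    have h0 : (fun i => eval t (f i)) ≠ 0 := Function.ne_iff.mpr ⟨i, right_ne_zero_of_mul ht⟩
    exact ⟨_, ⟨t, h0, rfl⟩, hFU t h0 (left_ne_zero_of_mul (left_ne_zero_of_mul ht)),
      hGV t h0 (right_ne_zero_of_mul (left_ne_zero_of_mul ht))⟩

end ParametrizedSet

/-! ### Krull dimension compared with the dimension of the cone. -/

section Dimension

open TopologicalSpace

variable {K : Type u} [Field K] {ι : Type v}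

theorem dim_mono {S T : Set (ℙ K (ι → K))} (h : S ⊆ T) : dim S ≤ dim T :=
  (Topology.IsEmbedding.inclusion h).isInducing.topologicalKrullDim_le

theorem dim_le_of_coneDim_le [CharZero K] [Fintype ι] {W : Set (ℙ K (ι → K))} {N : ℕ}
    (h : coneDim W ≤ (N + 1 : ℕ)) : dim W ≤ N := by
  let Y : IrreducibleCloseds W → IrreducibleCloseds (ℙ K (ι → K)) :=
    IrreducibleCloseds.map _ continuous_subtype_val
  have hY : StrictMono Y := IrreducibleCloseds.map_strictMono_of_isInducing .subtypeVal
  have hYW : ∀ Z, coneDim (Y Z : Set (ℙ K (ι → K))) ≤ (N + 1 : ℕ) := by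
    refine fun Z => (coneDim_mono ?_).trans h
    rw [IrreducibleCloseds.coe_map, vanishingIdeal_closure]
    exact vanishingIdeal_anti (Subtype.coe_image_subset W _)
  let d : IrreducibleCloseds W → ℕ := fun Z => (coneDim (Y Z : Set (ℙ K (ι → K)))).toNat
  have hd : ∀ Z, (d Z : Cardinal) = coneDim (Y Z : Set (ℙ K (ι → K))) :=
    fun Z => Cardinal.cast_toNat_of_lt_aleph0 (coneDim_lt_aleph0 _)
  have hd1 : ∀ Z, 1 ≤ d Z := fun Z => by
    have := one_le_coneDim (Y Z).isIrreducible.nonempty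
    rw [← hd] at this
    exact_mod_cast this
  have hdN : ∀ Z, d Z ≤ N + 1 := fun Z => by
    have := hYW Z
    rw [← hd] at this
    exact_mod_cast this
  have hmono : StrictMono d := by
    intro Z Z' hlt
    have hlt' : (Y Z : Set (ℙ K (ι → K))) ⊂ Y Z' := hY hlt
    have hI : vanishingIdeal (Y Z' : Set (ℙ K (ι → K))) < vanishingIdeal (Y Z) := by
      refine lt_of_le_not_ge (vanishingIdeal_anti hlt'.1) fun hle => hlt'.2 ?_
      have := closure_le_closure_of_vanishingIdeal_le hle
      rwa [(Y Z).isClosed.closure_eq, (Y Z').isClosed.closure_eq] at this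
    have := coneDim_strictMono (Y Z).isIrreducible (Y Z').isIrreducible hI
    rw [← hd, ← hd] at this
    exact_mod_cast this
  refine iSup_le fun p => ?_
  -- Members of the chain are nonempty, so d takes values in 1, …, N+1; the shift by one bounds the
  -- chain length by N.
  let f : Fin (p.length + 1) → Fin (N + 1) := fun i => ⟨d (p i) - 1, by have := hdN (p i); omega⟩
  have hf : StrictMono f := by
    intro i j hij
    have := hmono (p.strictMono hij)
    have h1 := hd1 (p i)
    change d (p i) - 1 < d (p j) - 1
    omega
  have := Fintype.card_le_of_injective f hf.injective
  simp only [Fintype.card_fin, add_le_add_iff_right] at this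
  exact_mod_cast this

theorem isIrreducible_preimage_val {X : Type*} [TopologicalSpace X] {W S : Set X} (hSW : S ⊆ W)
    (hS : IsIrreducible S) : IsIrreducible (Subtype.val ⁻¹' S : Set W) := by
  obtain ⟨⟨x, hx⟩, hpre⟩ := hS
  refine ⟨⟨⟨x, hSW hx⟩, hx⟩, ?_⟩
  rintro _ _ ⟨U, hU, rfl⟩ ⟨V, hV, rfl⟩ ⟨y, hyS, hyU⟩ ⟨z, hzS, hzV⟩
  obtain ⟨w, hwS, hw⟩ := hpre U V hU hV ⟨y, hyS, hyU⟩ ⟨z, hzS, hzV⟩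
  exact ⟨⟨w, hSW hwS⟩, hwS, hw⟩

/-- Closures are taken inside W; they stay distinct because the ambient closure of each recovers the
closure of `S j`. -/
theorem le_dim_of_chain {W : Set (ℙ K (ι → K))} {N : ℕ} (S : ℕ → Set (ℙ K (ι → K)))
    (hirr : ∀ j ≤ N, IsIrreducible (S j)) (hW : ∀ j ≤ N, S j ⊆ W)
    (hmono : ∀ j < N, S j ⊆ S (j + 1))
    (hne : ∀ j < N, closure (S j) ≠ closure (S (j + 1))) : (N : WithBot ℕ∞) ≤ dim W := by
  let Z : Fin (N + 1) → IrreducibleCloseds W := fun j =>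
    ⟨closure (Subtype.val ⁻¹' S j),
      (isIrreducible_preimage_val (hW j (by omega)) (hirr j (by omega))).closure, isClosed_closure⟩
  have hZ : ∀ j, closure (Subtype.val '' (Z j : Set W)) = closure (S j) := fun j => by
    change closure (Subtype.val '' closure (Subtype.val ⁻¹' S j)) = _
    rw [closure_image_closure continuous_subtype_val, Subtype.image_preimage_coe,
      Set.inter_eq_self_of_subset_right (hW j (by omega))]
  refine Order.le_krullDim_iff.mpr ⟨⟨N, Z, fun j => ?_⟩, rfl⟩
  change Z j.castSucc < Z j.succ
  refine lt_of_le_of_ne ?_ fun heq => hne j j.2 ?_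
  · exact closure_mono (Set.preimage_mono (hmono j j.2))
  · have h1 := hZ j.castSucc
    have h2 := hZ j.succ
    rw [heq, h2] at h1
    exact h1.symm

end Dimension

end SecantVariety

/-! ### Sums of points of the affine cone and their tangent spaces. -/

namespace SecantVariety

section SecantMap

variable {α β σ τ : Type}

/-- The sum of the vectors of monomials `u_i v_j v_l` over a finite family of pairs `(u, v)`. -/
def secantMap {R : Type*} [CommSemiring R] [Fintype σ] (u : σ → α → R) (v : σ → β → R) :
    α × Sym2 β → R :=
  fun m => ∑ s, u s m.1 * (m.2.map (v s)).mul

/-- The derivative of `secantMap` at `(u, v)` in the direction `(a, b)`. -/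
def secantTangent {R : Type*} [CommSemiring R] [Fintype σ] (u : σ → α → R) (v : σ → β → R)
    (a : σ → α → R) (b : σ → β → R) (i : α) (j l : β) : R :=
  ∑ s, (a s i * (v s j * v s l) + u s i * (b s j * v s l + v s j * b s l))

theorem secantMap_apply {R : Type*} [CommSemiring R] [Fintype σ] (u : σ → α → R) (v : σ → β → R)
    (i : α) (j l : β) : secantMap u v (i, s(j, l)) = ∑ s, u s i * (v s j * v s l) := by
  simp [secantMap]

theorem map_secantMap {R S : Type*} [CommSemiring R] [CommSemiring S] [Fintype σ] (φ : R →+* S)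
    (u : σ → α → R) (v : σ → β → R) (m : α × Sym2 β) :
    φ (secantMap u v m) = secantMap (fun s i => φ (u s i)) (fun s j => φ (v s j)) m := by
  obtain ⟨i, e⟩ := m
  induction e with
  | _ j l => simp [secantMap_apply]

variable {K : Type u} [Field K]

theorem secantMap_eq_sum_monomials12 [Fintype σ] (u : σ → α → K) (v : σ → β → K) :
    secantMap u v = ∑ s, monomials12 (u s) (v s) := by
  funext m
  simp [secantMap, monomials12]

theorem smul_monomials12 (c : K) (u : α → K) (v : β → K) :
    c • monomials12 u v = monomials12 (c • u) v := by
  funext m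
  simp [monomials12, mul_assoc]

theorem secantMap_eq_secantMap_normalized [Fintype σ] (u : σ → α → K) (v : σ → β → K) (j₀ : β)
    (h : ∀ s, v s j₀ ≠ 0) :
    secantMap u v =
      secantMap (fun s i => v s j₀ ^ 2 * u s i) (fun s j => v s j / v s j₀) := by
  funext m
  obtain ⟨i, e⟩ := m
  induction e with
  | _ j l =>
    simp only [secantMap_apply]
    refine Finset.sum_congr rfl fun s _ => ?_
    have := h s
    field_simp

/-- The points of projective space represented by the values of `secantMap`. -/
def secantPoints (K : Type u) [Field K] (α β σ : Type) [Fintype σ] : Set (ℙ K (α × Sym2 β → K)) :=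
  {p | ∃ (u : σ → α → K) (v : σ → β → K) (h : secantMap u v ≠ 0), p = Projectivization.mk K _ h}

section UpperBound

open MvPolynomial

variable [Fintype σ]

theorem eval_aeval_secantMap (U : σ → α → MvPolynomial τ K) (V : σ → β → MvPolynomial τ K)
    (F : MvPolynomial (α × Sym2 β) K) (t : τ → K) :
    eval t (aeval (secantMap U V) F) =
      eval (secantMap (fun s i => eval t (U s i)) (fun s j => eval t (V s j))) F := by
  rw [← funext (map_secantMap (eval t) U V)]
  induction F using MvPolynomial.induction_on with
  | C a => simp
  | add p q hp hq => rw [map_add, map_add, map_add, hp, hq]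
  | mul_X p i hp => rw [map_mul, map_mul, map_mul, hp, aeval_X, eval_X]

/-- Since u ⊗ v² = c²u ⊗ (v/c)², the chart where every `v s j₀` is 1 already determines all
polynomial relations, and it saves one parameter per summand. -/
theorem coneDim_secantPoints_le [Infinite K] [Fintype α] [Fintype β] (j₀ : β) :
    coneDim (secantPoints K α β σ) ≤
      (Fintype.card σ * (Fintype.card α + (Fintype.card β - 1)) : ℕ) := by
  classical
  have hcard : Fintype.card (σ × (α ⊕ {j : β // j ≠ j₀})) =
      Fintype.card σ * (Fintype.card α + (Fintype.card β - 1)) := by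
    rw [Fintype.card_prod, Fintype.card_sum]
    congr 2
    simp
  rw [← hcard]
  let U : σ → α → MvPolynomial (σ × (α ⊕ {j : β // j ≠ j₀})) K := fun s i => X (s, Sum.inl i)
  let V : σ → β → MvPolynomial (σ × (α ⊕ {j : β // j ≠ j₀})) K := fun s j =>
    if h : j = j₀ then 1 else X (s, Sum.inr ⟨j, h⟩)
  refine coneDim_le_of_ker_le (aeval (secantMap U V)) fun F hF => ?_
  have hchart : ∀ (u : σ → α → K) (v : σ → β → K), (∀ s, v s j₀ ≠ 0) →
      eval (secantMap u v) F = 0 := by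
    intro u v hv
    have := eval_aeval_secantMap U V F fun x =>
      x.2.elim (fun i => v x.1 j₀ ^ 2 * u x.1 i) (fun j : {j : β // j ≠ j₀} => v x.1 j / v x.1 j₀)
    rw [hF, map_zero] at this
    rw [secantMap_eq_secantMap_normalized u v j₀ hv, this]
    congr 3
    · funext s i
      simp [U]
    · funext s j
      by_cases h : j = j₀
      · subst h
        simp [V, hv s]
      · simp [V, h]
  have hall : ∀ (u : σ → α → K) (v : σ → β → K), eval (secantMap u v) F = 0 := by
    let U' : σ → α → MvPolynomial (σ × (α ⊕ β)) K := fun s i => X (s, Sum.inl i)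
    let V' : σ → β → MvPolynomial (σ × (α ⊕ β)) K := fun s j => X (s, Sum.inr j)
    -- Multiplication by the product of the coordinates `v s j₀` extends the vanishing from the
    -- chart to all (u, v).
    have h0 : aeval (secantMap U' V') F * ∏ s, X (s, Sum.inr j₀) = 0 := by
      refine MvPolynomial.funext fun t => ?_
      rw [map_mul, map_zero, eval_aeval_secantMap, map_prod]
      by_cases ht : ∀ s, t (s, Sum.inr j₀) ≠ 0
      · rw [hchart _ _ (by simpa [V'] using ht), zero_mul]
      · push Not at ht
        obtain ⟨s, hs⟩ := ht
        rw [Finset.prod_eq_zero (Finset.mem_univ s) (by rw [eval_X, hs]), mul_zero]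
    have h1 := (mul_eq_zero.mp h0).resolve_right
      (Finset.prod_ne_zero_iff.mpr fun s _ => X_ne_zero _)
    intro u v
    have := eval_aeval_secantMap U' V' F fun x => x.2.elim (u x.1) (v x.1)
    rw [h1, map_zero] at this
    simpa [U', V'] using this.symm
  rintro v hv ⟨a, b, h, hab⟩
  obtain ⟨c, hc⟩ := (Projectivization.mk_eq_mk_iff' K _ _ _ _).mp hab
  rw [← hc]
  have : c • secantMap a b = secantMap (fun s i => c * a s i) b := by
    funext m
    simp [secantMap, Finset.mul_sum, mul_assoc]
  rw [this]
  exact hall _ _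

end UpperBound

section LowerBound

open MvPolynomial

/-- An affine linear polynomial, given by its constant term and its linear coefficients. -/
noncomputable def affinePoly [Fintype τ] (c : K) (h : τ → K) : MvPolynomial τ K :=
  C c + ∑ k, C (h k) * X k

theorem eval_affinePoly [Fintype τ] (c : K) (h t : τ → K) :
    eval t (affinePoly c h) = c + ∑ k, t k * h k := by
  simp [affinePoly, mul_comm]

theorem pderiv_affinePoly [Fintype τ] (c : K) (h : τ → K) (k : τ) :
    pderiv k (affinePoly c h) = C (h k) := by
  classical
  simp [affinePoly, pderiv_X, Pi.single_apply]

variable [Fintype σ]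

/-- The composite of `secantMap` with the affine map `t ↦ p + ∑ k, t k • h k`. -/
noncomputable def secantPoly [Fintype τ] (p : (σ → α → K) × (σ → β → K))
    (h : τ → (σ → α → K) × (σ → β → K)) : α × Sym2 β → MvPolynomial τ K :=
  secantMap (fun s i => affinePoly (p.1 s i) fun k => (h k).1 s i)
    (fun s j => affinePoly (p.2 s j) fun k => (h k).2 s j)

theorem eval_secantPoly [Fintype τ] (p : (σ → α → K) × (σ → β → K))
    (h : τ → (σ → α → K) × (σ → β → K)) (t : τ → K) :
    (fun m => eval t (secantPoly p h m)) =
      secantMap (p + ∑ k, t k • h k).1 (p + ∑ k, t k • h k).2 := by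
  funext m
  rw [secantPoly, map_secantMap]
  congr 1
  · funext s i
    simp [eval_affinePoly, Prod.fst_sum, Finset.sum_apply]
  · funext s j
    simp [eval_affinePoly, Prod.snd_sum, Finset.sum_apply]

theorem sum_mul_eval_pderiv_secantPoly [Fintype τ] (p : (σ → α → K) × (σ → β → K))
    (h : τ → (σ → α → K) × (σ → β → K)) (c : τ → K) (i : α) (j l : β) :
    ∑ k, c k * eval 0 (pderiv k (secantPoly p h (i, s(j, l)))) =
      secantTangent p.1 p.2 (∑ k, c k • h k).1 (∑ k, c k • h k).2 i j l := by
  simp only [secantPoly, secantMap_apply, map_sum, pderiv_mul, pderiv_affinePoly, map_add, map_mul,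
    eval_affinePoly, eval_C, secantTangent, Prod.fst_sum, Prod.snd_sum, Finset.sum_apply,
    Prod.smul_fst, Prod.smul_snd, Pi.smul_apply, smul_eq_mul, Pi.zero_apply, zero_mul,
    Finset.sum_const_zero, add_zero]
  simp only [Finset.mul_sum, Finset.sum_mul]
  rw [Finset.sum_comm]
  refine Finset.sum_congr rfl fun s _ => ?_
  rw [← Finset.sum_add_distrib, Finset.mul_sum, ← Finset.sum_add_distrib]
  exact Finset.sum_congr rfl fun k _ => by ring

theorem parametrizedSet_secantPoly_subset [Fintype τ] (p : (σ → α → K) × (σ → β → K))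
    (h : τ → (σ → α → K) × (σ → β → K)) :
    parametrizedSet (secantPoly p h) ⊆ secantPoints K α β σ := by
  rintro q ⟨t, ht, rfl⟩
  have ht' := eval_secantPoly p h t
  refine ⟨_, _, ht' ▸ ht, ?_⟩
  congr 1

theorem secantTangent_smul_add (u : σ → α → K) (v : σ → β → K) (c : K)
    (a : σ → α → K) (b : σ → β → K) (i : α) (j l : β) :
    secantTangent u v (c • u + a) b i j l =
      c * secantMap u v (i, s(j, l)) + secantTangent u v a b i j l := by
  simp only [secantTangent, secantMap_apply, Finset.mul_sum, ← Finset.sum_add_distrib]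
  refine Finset.sum_congr rfl fun s _ => ?_
  simp only [Pi.add_apply, Pi.smul_apply, smul_eq_mul]
  ring

/-- The conditions on the second components remove the rescaling of each pair (u, v); the last one
makes the directions independent of the overall scaling direction (u, 0) when `u s₀ i₀` ≠ 0. -/
theorem exists_linearIndependent_coordinates_eq_zero [Fintype α] [Fintype β] (l : σ → β) (s₀ : σ)
    (i₀ : α) (N : ℕ)
    (hN : N + 1 = Fintype.card σ * (Fintype.card α + (Fintype.card β - 1))) :
    ∃ e : Fin N → (σ → α → K) × (σ → β → K), LinearIndependent K e ∧
      ∀ k, (∀ s, (e k).2 s (l s) = 0) ∧ (e k).1 s₀ i₀ = 0 := by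
  let L : ((σ → α → K) × (σ → β → K)) →ₗ[K] (σ → K) × K :=
    { toFun := fun x => (fun s => x.2 s (l s), x.1 s₀ i₀)
      map_add' := fun _ _ => rfl
      map_smul' := fun _ _ => rfl }
  have hrank := L.finrank_range_add_finrank_ker
  have hE : Module.finrank K ((σ → α → K) × (σ → β → K)) =
      Fintype.card σ * (Fintype.card α + Fintype.card β) := by
    simp [Module.finrank_prod, Module.finrank_pi_fintype, mul_add]
  have hrange : Module.finrank K (LinearMap.range L) ≤ Fintype.card σ + 1 := by
    refine (Submodule.finrank_le _).trans ?_
    simp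
  have hβ : Fintype.card β = (Fintype.card β - 1) + 1 :=
    (Nat.succ_pred_eq_of_pos (Fintype.card_pos_iff.mpr ⟨l s₀⟩)).symm
  have hle : N ≤ Module.finrank K (LinearMap.ker L) := by
    rw [hE, hβ, ← add_assoc, mul_add, ← hN] at hrank
    omega
  obtain ⟨f, hf⟩ := exists_linearIndependent_of_le_finrank hle
  refine ⟨fun k => f k, hf.map' (LinearMap.ker L).subtype (Submodule.ker_subtype _), fun k => ?_⟩
  have hk : L (f k) = 0 := (f k).2
  exact ⟨fun s => congrFun (congrArg Prod.fst hk) s, congrArg Prod.snd hk⟩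

/-- If the tangent space at `(u, v)` to the sums of points of the affine cone over the
Segre-Veronese variety has the largest possible dimension, the points of `secantPoints`
fill a set of the expected dimension. -/
theorem dim_eq_of_secantTangent_injective [CharZero K] [Fintype α] [Fintype β]
    {W : Set (ℙ K (α × Sym2 β → K))} (hle : secantPoints K α β σ ⊆ W)
    (hge : W ⊆ closure (secantPoints K α β σ))
    (u : σ → α → K) (v : σ → β → K) (l : σ → β) (s₀ : σ) (i₀ : α) (hu : u s₀ i₀ ≠ 0)
    (htan : ∀ (a : σ → α → K) (b : σ → β → K), (∀ s, b s (l s) = 0) →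
      (∀ i j k, secantTangent u v a b i j k = 0) → a = 0 ∧ b = 0)
    (N : ℕ) (hN : N + 1 = Fintype.card σ * (Fintype.card α + (Fintype.card β - 1))) :
    dim W = N := by
  apply le_antisymm
  · refine dim_le_of_coneDim_le ((coneDim_mono ?_).trans
      ((coneDim_secantPoints_le (l s₀)).trans_eq (by rw [hN])))
    rw [← vanishingIdeal_closure]
    exact vanishingIdeal_anti hge
  · obtain ⟨e, heind, he⟩ :=
      exists_linearIndependent_coordinates_eq_zero (K := K) l s₀ i₀ N hN
    let e' : ℕ → (σ → α → K) × (σ → β → K) := fun k => if hk : k < N then e ⟨k, hk⟩ else 0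
    let f : (j : ℕ) → α × Sym2 β → MvPolynomial (Fin j) K := fun j =>
      secantPoly (u, v) fun k : Fin j => e' k
    have hinj : ∀ j ≤ N, ∀ (a : K) (c : Fin j → K),
        (∀ m, a * eval 0 (f j m) + ∑ k, c k * eval 0 (pderiv k (f j m)) = 0) →
          a = 0 ∧ c = 0 := by
      intro j hj a c hac
      have he' : (fun k : Fin j => e' k) = e ∘ Fin.castLE hj := by
        funext k
        simp [e', k.2.trans_le hj]
        rfl
      have hcoord : (∀ s, (∑ k : Fin j, c k • e' k).2 s (l s) = 0) ∧
          (∑ k : Fin j, c k • e' k).1 s₀ i₀ = 0 := by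
        have hk : ∀ k : Fin j, e' k = e (Fin.castLE hj k) := congrFun he'
        simp only [hk, Prod.fst_sum, Prod.snd_sum, Finset.sum_apply, Prod.smul_fst, Prod.smul_snd,
          Pi.smul_apply, smul_eq_mul, (he _).1, (he _).2, mul_zero, Finset.sum_const_zero,
          implies_true, and_self]
      have h0 : ∀ m, eval 0 (f j m) = secantMap u v m := by
        intro m
        have := congrFun (eval_secantPoly (u, v) (fun k : Fin j => e' k) 0) m
        simpa using this
      -- The radial vector `secantMap u v` is itself the tangent in direction (u, 0), so the scale a
      -- is absorbed into the first component.
      obtain ⟨h1, h2⟩ := htan (a • u + (∑ k : Fin j, c k • e' k).1)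
        (∑ k : Fin j, c k • e' k).2 hcoord.1 fun i j' l' => by
          rw [secantTangent_smul_add, ← h0]
          have := hac (i, s(j', l'))
          rwa [sum_mul_eval_pderiv_secantPoly] at this
      have ha : a = 0 := by
        have := congrFun (congrFun h1 s₀) i₀
        simp only [Pi.add_apply, Pi.smul_apply, smul_eq_mul, hcoord.2, add_zero,
          Pi.zero_apply] at this
        exact (mul_eq_zero.mp this).resolve_right hu
      rw [ha, zero_smul, zero_add] at h1
      refine ⟨ha, ?_⟩
      have hli : LinearIndependent K fun k : Fin j => e' k := by
        rw [he']
        exact heind.comp _ (Fin.castLE_injective hj)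
      funext k
      exact Fintype.linearIndependent_iff.mp hli c (Prod.ext h1 h2) k
    have hdim : ∀ j ≤ N, ((j + 1 : ℕ) : Cardinal) ≤ coneDim (parametrizedSet (f j)) := by
      intro j hj
      have := le_coneDim (S := parametrizedSet (f j)) subset_rfl (hinj j hj)
      rwa [Fintype.card_fin] at this
    refine le_dim_of_chain (fun j => parametrizedSet (f j)) (fun j hj => ?_) (fun j _ => ?_)
      (fun j _ => ?_) (fun j hj heq => ?_)
    · refine parametrizedSet_isIrreducible ?_
      intro hf
      exact one_ne_zero (hinj j hj 1 0 (fun m => by simp [hf])).1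
    · exact (parametrizedSet_secantPoly_subset _ _).trans hle
    · rintro q ⟨t, ht, rfl⟩
      have : (fun m => eval (Fin.snoc t 0 : Fin (j + 1) → K) (f (j + 1) m)) =
          fun m => eval t (f j m) := by
        rw [eval_secantPoly, eval_secantPoly]
        simp [Fin.sum_univ_castSucc]
      refine ⟨Fin.snoc t 0, this ▸ ht, ?_⟩
      congr 1
      exact this.symm
    -- Equal closures have equal vanishing ideals, which would give j + 2 ≤ `coneDim` ≤ j + 1.
    · have h1 := hdim (j + 1) hj
      have h2 : coneDim (parametrizedSet (f (j + 1))) ≤ coneDim (parametrizedSet (f j)) := by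
        refine coneDim_mono ?_
        rw [← vanishingIdeal_closure, heq, vanishingIdeal_closure]
      have h3 := (h1.trans h2).trans (coneDim_parametrizedSet_le (f j))
      rw [Fintype.card_fin, Nat.cast_le] at h3
      omega

end LowerBound

end SecantMap

end SecantVariety

/-! ### Secant varieties as closures of sums of points. -/

namespace SecantVariety

section SecantVariety

variable {K : Type u} [Field K] {α β : Type}

theorem range_segreVeroneseMap_nonempty [Nonempty α] [Nonempty β] :
    (Set.range (segreVeroneseMap : ℙ K (α → K) × ℙ K (β → K) → _)).Nonempty := by
  have h : ∀ (γ : Type) [Nonempty γ], (fun _ => 1 : γ → K) ≠ 0 := fun γ _ h =>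
    one_ne_zero (congrFun h (Classical.arbitrary γ))
  exact ⟨_, (Projectivization.mk K _ (h α), Projectivization.mk K _ (h β)), rfl⟩

theorem secantVariety_range_segreVeroneseMap [Nonempty α] [Nonempty β] (k : ℕ) :
    secantVariety k (Set.range (segreVeroneseMap : ℙ K (α → K) × ℙ K (β → K) → _)) =
      closure (secantPoints K α β (Fin k)) := by
  rw [secantVariety]
  congr 1
  ext p
  constructor
  · rintro ⟨x, hx, hp⟩
    choose y hy using hx
    have hsub : ∀ i, (x i).submodule = K ∙ monomials12 (y i).1.rep (y i).2.rep := fun i => by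
      rw [← hy i]
      exact Projectivization.submodule_mk _ _
    simp only [hsub] at hp
    rw [← Submodule.span_range_eq_iSup] at hp
    have hrep : p.rep ∈ p.submodule := by
      rw [p.submodule_eq]
      exact Submodule.mem_span_singleton_self _
    obtain ⟨c, hc⟩ := (Submodule.mem_span_range_iff_exists_fun K).mp (hp hrep)
    have hsec : secantMap (fun s => c s • (y s).1.rep) (fun s => (y s).2.rep) = p.rep := by
      rw [secantMap_eq_sum_monomials12, ← hc]
      simp only [smul_monomials12]
    refine ⟨_, _, hsec ▸ p.rep_nonzero, ?_⟩
    conv_lhs => rw [← p.mk_rep]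
    congr 1
    exact hsec.symm
  · rintro ⟨u, v, h, rfl⟩
    obtain ⟨q, hq⟩ := range_segreVeroneseMap_nonempty (K := K) (α := α) (β := β)
    classical
    -- A summand with a zero factor contributes nothing to the sum, so an arbitrary point q of the
    -- variety fills its slot.
    let x : Fin k → ℙ K (α × Sym2 β → K) := fun s =>
      if huv : u s ≠ 0 ∧ v s ≠ 0 then
        Projectivization.mk K (monomials12 (u s) (v s)) (monomials12_ne_zero huv.1 huv.2) else q
    refine ⟨x, fun s => ?_, ?_⟩
    · by_cases huv : u s ≠ 0 ∧ v s ≠ 0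
      · simp only [x, dif_pos huv]
        exact ⟨_, segreVeroneseMap_mk _ _ huv.1 huv.2⟩
      · simpa only [x, dif_neg huv] using hq
    · rw [Projectivization.submodule_mk, Submodule.span_singleton_le_iff_mem,
        secantMap_eq_sum_monomials12]
      refine Submodule.sum_mem _ fun s _ => ?_
      by_cases huv : u s ≠ 0 ∧ v s ≠ 0
      · refine Submodule.mem_iSup_of_mem s ?_
        simp only [x, dif_pos huv, Projectivization.submodule_mk]
        exact Submodule.mem_span_singleton_self _
      · have : monomials12 (u s) (v s) = 0 := by
          funext ⟨i, e⟩
          induction e with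
          | _ j l =>
            by_cases hu : u s = 0
            · simp [monomials12, hu]
            · have hv : v s = 0 := by tauto
              simp [monomials12, hv]
        rw [this]
        exact zero_mem _

theorem range_segreVeroneseMap_eq_secantPoints [Nonempty α] [Nonempty β] :
    Set.range (segreVeroneseMap : ℙ K (α → K) × ℙ K (β → K) → _) =
      secantPoints K α β (Fin 1) := by
  ext p
  constructor
  · rintro ⟨x, rfl⟩
    have hsec : secantMap (fun _ : Fin 1 => x.1.rep) (fun _ => x.2.rep) =
        monomials12 x.1.rep x.2.rep := by
      simp [secantMap_eq_sum_monomials12]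
    refine ⟨_, _, hsec ▸ monomials12_ne_zero x.1.rep_nonzero x.2.rep_nonzero, ?_⟩
    rw [segreVeroneseMap]
    congr 1
    exact hsec.symm
  · rintro ⟨u, v, h, rfl⟩
    have hsec : secantMap u v = monomials12 (u 0) (v 0) := by
      simp [secantMap_eq_sum_monomials12]
    have hu : u 0 ≠ 0 := fun h0 => h (by rw [hsec, h0]; funext m; simp [monomials12])
    have hv : v 0 ≠ 0 := fun h0 => h (by
      rw [hsec, h0]
      funext ⟨i, e⟩
      induction e with
      | _ j l => simp [monomials12])
    refine ⟨_, (segreVeroneseMap_mk _ _ hu hv).trans ?_⟩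
    congr 1
    exact hsec.symm

end SecantVariety

/-! ### The tangent space computation at the chosen points. -/

section Tangent

variable {n : ℕ}

/-- The first factors of `n + 1` points of `ℙ² × ℙⁿ⁻¹`: the point `(0, 1, 0)` and points of
a conic. -/
def conicPoints (n : ℕ) : Fin (n + 1) → Fin 3 → ℂ :=
  Fin.cons ![0, 1, 0] fun j => ![1, (j : ℂ) + 1, ((j : ℂ) + 1) ^ 2]

/-- The second factors of `n + 1` points of `ℙ² × ℙⁿ⁻¹`: the unit point and the coordinate
points. -/
def coordinatePoints (n : ℕ) : Fin (n + 1) → Fin n → ℂ :=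
  Fin.cons (fun _ => 1) fun j => Pi.single j 1

theorem secantTangent_conicPoints_coordinatePoints (a : Fin (n + 1) → Fin 3 → ℂ)
    (b : Fin (n + 1) → Fin n → ℂ) (i : Fin 3) (j l : Fin n) :
    secantTangent (conicPoints n) (coordinatePoints n) a b i j l =
      a 0 i + conicPoints n 0 i * (b 0 j + b 0 l) + ((if j = l then a j.succ i else 0) +
        (conicPoints n l.succ i * b l.succ j + conicPoints n j.succ i * b j.succ l)) := by
  rw [secantTangent, Fin.sum_univ_succ]
  simp only [coordinatePoints, Fin.cons_zero, Fin.cons_succ, Pi.single_apply, mul_one, one_mul,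
    mul_add, mul_ite, mul_zero, ite_mul, zero_mul, Finset.sum_add_distrib, Finset.sum_ite_eq,
    Finset.mem_univ, if_true]
  by_cases h : j = l <;> simp [h]

/-- Alternating sums of γ j + γ l around the 4-cycles 0-1-3-2 and 0-1-4-2 cancel γ and leave 5A + B
= 0 and 61A + 11B = 0. Then all sums of pairs vanish, and any three indices give γ = 0. The second
cycle is where five indices are needed. -/
theorem eq_zero_of_forall_pair_sum (hn : 5 ≤ n) (A B : ℂ) (γ : Fin n → ℂ)
    (h : ∀ j l : Fin n, j ≠ l → ((j : ℂ) + 1 + (l + 1)) * (γ j + γ l) =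
      A * ((j + 1) * (l + 1)) + B) : A = 0 ∧ B = 0 ∧ ∀ j, γ j = 0 := by
  have hc : ∀ j l (hj : j < n) (hl : l < n), j ≠ l →
      ((j : ℂ) + 1 + (l + 1)) * (γ ⟨j, hj⟩ + γ ⟨l, hl⟩) = A * ((j + 1) * (l + 1)) + B :=
    fun j l hj hl hjl => h ⟨j, hj⟩ ⟨l, hl⟩ (by simpa using hjl)
  have h01 := hc 0 1 (by omega) (by omega) (by omega)
  have h02 := hc 0 2 (by omega) (by omega) (by omega)
  have h13 := hc 1 3 (by omega) (by omega) (by omega)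
  have h23 := hc 2 3 (by omega) (by omega) (by omega)
  have h14 := hc 1 4 (by omega) (by omega) (by omega)
  have h24 := hc 2 4 (by omega) (by omega) (by omega)
  push_cast at h01 h02 h13 h23 h14 h24
  have hA : A = 0 := by grind
  have hB : B = 0 := by grind
  have hsum : ∀ j l : Fin n, j ≠ l → γ j + γ l = 0 := by
    intro j l hjl
    have := h j l hjl
    rw [hA, hB, zero_mul, zero_add] at this
    refine (mul_eq_zero.mp this).resolve_left ?_
    have h1 : ((j : ℂ) + 1 + (l + 1)) = ((j + l + 1 : ℕ) : ℂ) + 1 := by push_cast; ring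
    rw [h1]
    exact Nat.cast_add_one_ne_zero _
  refine ⟨hA, hB, fun j => ?_⟩
  obtain ⟨k, l, hjk, hjl, hkl⟩ : ∃ k l : Fin n, j ≠ k ∧ j ≠ l ∧ k ≠ l := by
    have h2 : 1 < (Finset.univ.erase j).card := by
      rw [Finset.card_erase_of_mem (Finset.mem_univ j), Finset.card_univ, Fintype.card_fin]
      omega
    obtain ⟨k, hk, l, hl, hkl⟩ := Finset.one_lt_card.mp h2
    exact ⟨k, l, (Finset.ne_of_mem_erase hk).symm, (Finset.ne_of_mem_erase hl).symm, hkl⟩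
  linear_combination (hsum j k hjk + hsum j l hjl - hsum k l hkl) / 2

theorem eq_zero_of_secantTangent_eq_zero (hn : 5 ≤ n) (a : Fin (n + 1) → Fin 3 → ℂ)
    (b : Fin (n + 1) → Fin n → ℂ) (hb0 : b 0 ⟨0, by omega⟩ = 0) (hb : ∀ j, b (Fin.succ j) j = 0)
    (h : ∀ i j l, secantTangent (conicPoints n) (coordinatePoints n) a b i j l = 0) :
    a = 0 ∧ b = 0 := by
  simp only [secantTangent_conicPoints_coordinatePoints] at h
  have h0 : ∀ j l, j ≠ l → a 0 0 + (b l.succ j + b j.succ l) = 0 := by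
    intro j l hjl
    simpa [conicPoints, hjl] using h 0 j l
  have h1 : ∀ j l : Fin n, j ≠ l → a 0 1 + (b 0 j + b 0 l) +
      (((l : ℂ) + 1) * b l.succ j + ((j : ℂ) + 1) * b j.succ l) = 0 := by
    intro j l hjl
    simpa [conicPoints, hjl] using h 1 j l
  have h2 : ∀ j l : Fin n, j ≠ l → a 0 2 +
      (((l : ℂ) + 1) ^ 2 * b l.succ j + ((j : ℂ) + 1) ^ 2 * b j.succ l) = 0 := by
    intro j l hjl
    simpa [conicPoints, hjl] using h 2 j l
  -- The polynomial T² − (t_j + t_l)T + t_j t_l vanishes at t_j and t_l, so this combination of the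
  -- three equations removes `b l.succ j` and `b j.succ l`. The constant `a 0 1` is split evenly
  -- between γ j and γ l.
  obtain ⟨hA, hB, hγ⟩ := eq_zero_of_forall_pair_sum hn (a 0 0) (a 0 2)
    (fun j => b 0 j + a 0 1 / 2) fun j l hjl => by
      linear_combination ((j : ℂ) + 1 + (l + 1)) * h1 j l hjl -
        ((j : ℂ) + 1) * (l + 1) * h0 j l hjl - h2 j l hjl
  have ha1 : a 0 1 = 0 := by
    have := hγ ⟨0, by omega⟩
    rw [hb0] at this
    linear_combination 2 * this
  have hb0' : ∀ j, b 0 j = 0 := fun j => by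
    linear_combination hγ j - ha1 / 2
  have ha0 : ∀ i, a 0 i = 0 := fun i => by fin_cases i <;> assumption
  have hbs : ∀ j l, b (Fin.succ l) j = 0 := by
    intro j l
    by_cases hjl : j = l
    · rw [hjl, hb]
    have e0 := h0 j l hjl
    have e1 := h1 j l hjl
    rw [hb0', hb0', ha1] at e1
    rw [hA] at e0
    have hne : (l : ℂ) - j ≠ 0 := by
      rw [sub_ne_zero]
      exact fun hlj => hjl (Fin.ext (by exact_mod_cast hlj.symm))
    refine (mul_eq_zero.mp ?_).resolve_left hne
    -- What remains is a 2 × 2 Vandermonde system with nodes t_j ≠ t_l.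
    linear_combination e1 - ((j : ℂ) + 1) * e0
  constructor
  · funext s i
    -- Once everything else is zero, the diagonal equation (j, j) reads `a j.succ i` = 0.
    refine Fin.cases (ha0 i) (fun j => ?_) s
    simpa [ha0, hb0', hbs] using h i j j
  · funext s j
    exact Fin.cases (hb0' j) (fun l => hbs j l) s

end Tangent

/-! ### Dimensions of X and of its secant variety. -/

theorem dim_segreVeronese (n : ℕ) (hn : 1 ≤ n) : dim (segreVeronese n) = (n + 1 : ℕ) := by
  have : Nonempty (Fin n) := ⟨⟨0, hn⟩⟩
  rw [segreVeronese, range_segreVeroneseMap_eq_secantPoints]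
  refine dim_eq_of_secantTangent_injective (σ := Fin 1) subset_rfl subset_closure
    (fun _ _ => 1) (fun _ _ => 1) (fun _ => ⟨0, hn⟩) 0 0 one_ne_zero (fun a b hb h => ?_) _ ?_
  · simp only [secantTangent, Finset.univ_unique, Finset.sum_singleton, one_mul, mul_one] at h
    have ha : ∀ i, a default i = 0 := fun i => by
      have := h i ⟨0, hn⟩ ⟨0, hn⟩
      rw [hb, add_zero, add_zero] at this
      exact this
    constructor
    · funext s i
      rw [Subsingleton.elim s default]
      exact ha i
    · funext s j
      rw [Subsingleton.elim s default]
      have := h 0 j ⟨0, hn⟩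
      rw [hb, add_zero, ha, zero_add] at this
      exact this
  · simp only [Fintype.card_fin]
    omega

theorem dim_secantVariety_segreVeronese (n : ℕ) (hn : 5 ≤ n) :
    dim (secantVariety (n + 1) (segreVeronese n)) = ((n + 1) ^ 2 + n : ℕ) := by
  have : Nonempty (Fin n) := ⟨⟨0, by omega⟩⟩
  rw [segreVeronese, secantVariety_range_segreVeroneseMap]
  -- The normalised coordinate is 0 for the unit point and j for e_j, where the entry is 1; the pair
  -- 0, 1 selects the nonzero entry of (0,1,0).
  refine dim_eq_of_secantTangent_injective (σ := Fin (n + 1)) subset_closure subset_rfl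
    (conicPoints n) (coordinatePoints n) (Fin.cons ⟨0, by omega⟩ id) 0 1 ?_
    (fun a b hb h => eq_zero_of_secantTangent_eq_zero hn a b (hb 0) (fun j => hb j.succ) h) _ ?_
  · simp [conicPoints]
  · simp only [Fintype.card_fin]
    obtain ⟨m, rfl⟩ := Nat.exists_eq_add_of_le' hn
    rw [show m + 5 - 1 = m + 4 by omega]
    ring

end SecantVariety

theorem theorem6p8 (n : ℕ) (hn : 5 ≤ n) :
    SecantVariety.dim (SecantVariety.secantVariety (n + 1) (SecantVariety.segreVeronese n)) =
        SecantVariety.expectedDim (n + 1) (SecantVariety.segreVeronese n) ∧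
      SecantVariety.dim (SecantVariety.secantVariety (n + 1) (SecantVariety.segreVeronese n)) =
        (((n + 1) ^ 2 + n : ℕ) : WithBot ℕ∞) := by
  have hdim := SecantVariety.dim_secantVariety_segreVeronese n hn
  refine ⟨?_, hdim⟩
  have huniv := SecantVariety.dim_mono
    (Set.subset_univ (SecantVariety.secantVariety (n + 1) (SecantVariety.segreVeronese n)))
  have hexp : ((n + 1 : ℕ) : WithBot ℕ∞) * SecantVariety.dim (SecantVariety.segreVeronese n) +
      ((n + 1 - 1 : ℕ) : WithBot ℕ∞) = (((n + 1) ^ 2 + n : ℕ) : WithBot ℕ∞) := by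
    rw [SecantVariety.dim_segreVeronese n (by omega), Nat.add_sub_cancel, sq]
    push_cast
    rfl
  -- Since the secant variety attains the parameter count, monotonicity of `dim` shows that the
  -- ambient dimension is at least that count, so the minimum needs no value of m.
  rw [SecantVariety.expectedDim, hexp, ← hdim, min_eq_right huniv]
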